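/- Let $X$ be a separable, infinite-dimensional Banach space over $\mathbb{F}\in\{\mathbb{R},\mathbb{C}\}$. For bounded linear operators on $X$, write $\mathcal{HC}(T)$ for the set of $x\in X$ whose orbit $\{T^n x : n\in\mathbb{N}\}$ is dense in $X$, and $\text{d-}\mathcal{HC}(T_1,T_2)$ for the set of $x\in X$ such that $\{(T_1^n x, T_2^n x) : n\in\mathbb{N}\}$ is dense in $X\times X$. Call $T_1,T_2$ densely d-hypercyclic if $\text{d-}\mathcal{HC}(T_1,T_2)$ is dense in $X$. A hypercyclic subspace of $T$ is a closed infinite-dimensional linear subspace $Y\subseteq X$ with $Y\setminus\{0\}\subseteq\mathcal{HC}(T)$; a d-hypercyclic subspace of $T_1,T_2$ is a closed infinite-dimensional linear subspace $Y\subseteq X$ with $Y\setminus\{0\}\subseteq\text{d-}\mathcal{HC}(T_1,T_2)$. Then there exist bounded linear operators $T_1,T_2$ on $X$ that are densely d-hypercyclic and have a common hypercyclic subspace (a single $Y$ that is a hypercyclic subspace of both $T_1$ and $T_2$), but have no d-hypercyclic subspace. Moreover, $T_1,T_2$ can be chosen so that, in addition, every nonzero linear subspace (closed or not) of $X$ contained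 in $\text{d-}\mathcal{HC}(T_1,T_2)\cup\{0\}$ is one-dimensional. -/

import Mathlib

/-- The set `HC(T)` of hypercyclic vectors of a bounded operator `T`: the vectors `x` whose orbit
`{T ^ n x : n ∈ ℕ}` is dense. -/
def hypercyclicVectors {𝕜 X : Type*} [RCLike 𝕜] [NormedAddCommGroup X] [NormedSpace 𝕜 X]
    (T : X →L[𝕜] X) : Set X :=
  {x | Dense (Set.range fun n : ℕ => (T ^ n) x)}

/-- The set `d-HC(T_1, …, T_N)` of d-hypercyclic vectors of bounded operators `T_1, …, T_N`: the
vectors `x` for which `{(T_1 ^ n x, …, T_N ^ n x) : n ∈ ℕ}` is dense in the product space `X ^ N`. -/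
def dHypercyclicVectors {𝕜 X : Type*} [RCLike 𝕜] [NormedAddCommGroup X] [NormedSpace 𝕜 X]
    {N : ℕ} (T : Fin N → (X →L[𝕜] X)) : Set X :=
  {x | Dense (Set.range fun n : ℕ => fun i : Fin N => (T i ^ n) x)}

/-- The operators are densely d-hypercyclic if their d-hypercyclic vectors are dense in `X`. -/
def DenselyDHypercyclic {𝕜 X : Type*} [RCLike 𝕜] [NormedAddCommGroup X] [NormedSpace 𝕜 X]
    {N : ℕ} (T : Fin N → (X →L[𝕜] X)) : Prop :=
  Dense (dHypercyclicVectors T)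

/-- A hypercyclic subspace of `T`: a closed infinite-dimensional subspace all of whose nonzero
vectors are hypercyclic for `T`. -/
def IsHypercyclicSubspace {𝕜 X : Type*} [RCLike 𝕜] [NormedAddCommGroup X] [NormedSpace 𝕜 X]
    (T : X →L[𝕜] X) (Y : Submodule 𝕜 X) : Prop :=
  IsClosed (Y : Set X) ∧ ¬ FiniteDimensional 𝕜 Y ∧
    ∀ y ∈ Y, y ≠ 0 → y ∈ hypercyclicVectors T

/-- A d-hypercyclic subspace: a closed infinite-dimensional subspace all of whose nonzero
vectors are d-hypercyclic for the given operators. -/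
def IsDHypercyclicSubspace {𝕜 X : Type*} [RCLike 𝕜] [NormedAddCommGroup X] [NormedSpace 𝕜 X]
    {N : ℕ} (T : Fin N → (X →L[𝕜] X)) (Y : Submodule 𝕜 X) : Prop :=
  IsClosed (Y : Set X) ∧ ¬ FiniteDimensional 𝕜 Y ∧
    ∀ y ∈ Y, y ≠ 0 → y ∈ dHypercyclicVectors T

/-!
Let `B` be a nuclear weighted backward shift along infinitely many infinite strands of a
biorthogonal system with dense span, and let `T = exp B`. Then `T` is the identity on `ker B`,
which is infinite-dimensional. On a rescaled strand `B` acts like the derivative on polynomials and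
`T` like the translation `p(x) ↦ p(x + 1)`, so two-point Hermite interpolation combined with a
dilation shows that `T` is mixing; hence so is `T ⊕ T ⊕ ⋯` on `ℓ¹(ℕ, X)`, which has a hypercyclic
vector `h = (h₀, h₁, …)`.

For a separating sequence of functionals `fᵢ` in the dual unit ball and small `c ≠ 0`, the map
`S m = m + c ∑ fᵢ(m) hᵢ` is an isomorphism, and `Tⁿ S m = m + c ∑ fᵢ(m) Tⁿ hᵢ` for `m ∈ ker B`. So
`S (ker B)` is a hypercyclic subspace of `T`.

Put `T₁ = T` and `T₂ = L⁻¹ T L` with `L x = x + f(x) h₀` invertible. A vector `x` is d-hypercyclic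
for `T₁, T₂` exactly when `(x, L x)` has a dense orbit under `T ⊕ T`. This fails when `f(x) = 0`,
since then `L x = x`, and holds for `x = h₁ + Tᵏ h₀` when `f(x) ≠ 0`. A subspace of d-hypercyclic
vectors therefore meets `ker f` only in `0`, so it is at most one-dimensional, while on `ker f` the
operators `T₁` and `T₂` have the same hypercyclic vectors.
-/

section Mixing

open Filter Topology Set TopologicalSpace

theorem exists_denseRange_apply {ι α β : Type*} [TopologicalSpace α] [BaireSpace α] [Nonempty α]
    [TopologicalSpace β] [SecondCountableTopology β] {F : ι → α → β} (hF : ∀ i, Continuous (F i))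
    (htrans : ∀ U V, IsOpen U → U.Nonempty → IsOpen V → V.Nonempty → ∃ i, ∃ x ∈ U, F i x ∈ V) :
    ∃ x, DenseRange fun i => F i x := by
  have hbasis := isBasis_countableBasis β
  have hdense : Dense (⋂ V ∈ countableBasis β, ⋃ i, F i ⁻¹' V) := by
    refine dense_biInter_of_isOpen
      (fun V hV => isOpen_iUnion fun i => (hbasis.isOpen hV).preimage (hF i))
      (countable_countableBasis β) fun V hV => dense_iff_inter_open.2 fun U hU hUne => ?_
    obtain ⟨i, x, hxU, hxV⟩ :=
      htrans U V hU hUne (hbasis.isOpen hV) (nonempty_of_mem_countableBasis hV)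
    exact ⟨x, hxU, mem_iUnion.2 ⟨i, hxV⟩⟩
  obtain ⟨x, hx⟩ := hdense.nonempty
  refine ⟨x, hbasis.dense_iff.2 fun V hV _ => ?_⟩
  obtain ⟨i, hi⟩ := mem_iUnion.1 (mem_iInter₂.1 hx V hV)
  exact ⟨F i x, hi, i, rfl⟩

variable {𝕜 E : Type*} [RCLike 𝕜] [NormedAddCommGroup E] [NormedSpace 𝕜 E]

/-- The pairs `(x, y)` for which there are `z n → x` with `T ^ n (z n) → y`. The operator `T` is
topologically mixing as soon as they are dense in `E × E`, and being a subspace they can be found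
one generator at a time. -/
def orbitLimitPairs (T : E →L[𝕜] E) : Submodule 𝕜 (E × E) where
  carrier := {p | ∃ z : ℕ → E, Tendsto z atTop (𝓝 p.1) ∧
    Tendsto (fun n => (T ^ n) (z n)) atTop (𝓝 p.2)}
  add_mem' := by
    rintro p q ⟨z, hz, hz'⟩ ⟨w, hw, hw'⟩
    exact ⟨fun n => z n + w n, hz.add hw, by simpa only [map_add, Prod.snd_add] using hz'.add hw'⟩
  zero_mem' := ⟨fun _ => 0, tendsto_const_nhds, by simp⟩
  smul_mem' := by
    rintro c p ⟨z, hz, hz'⟩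
    exact ⟨fun n => c • z n, hz.const_smul c, by
      simpa only [map_smul, Prod.smul_snd] using hz'.const_smul c⟩

theorem mk_mem_orbitLimitPairs_of_mem_span {T : E →L[𝕜] E} {D : Set E}
    (hD : ∀ d ∈ D, (d, 0) ∈ orbitLimitPairs T ∧ (0, d) ∈ orbitLimitPairs T) {x y : E}
    (hx : x ∈ Submodule.span 𝕜 D) (hy : y ∈ Submodule.span 𝕜 D) :
    (x, y) ∈ orbitLimitPairs T := by
  have hleft : Submodule.span 𝕜 D ≤ (orbitLimitPairs T).comap (LinearMap.inl 𝕜 E E) :=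
    Submodule.span_le.2 fun d hd => (hD d hd).1
  have hright : Submodule.span 𝕜 D ≤ (orbitLimitPairs T).comap (LinearMap.inr 𝕜 E E) :=
    Submodule.span_le.2 fun d hd => (hD d hd).2
  simpa using (orbitLimitPairs T).add_mem (hleft hx) (hright hy)

theorem separableSpace_of_dense_span {D : Set E} (hc : D.Countable)
    (hdense : Dense (Submodule.span 𝕜 D : Set E)) : SeparableSpace E := by
  rw [← isSeparable_univ_iff, ← hdense.closure_eq]
  exact hc.isSeparable.span.closure

theorem exists_mem_hypercyclicVectors [CompleteSpace E] {T : E →L[𝕜] E} {D : Set E}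
    (hc : D.Countable) (hdense : Dense (Submodule.span 𝕜 D : Set E))
    (hD : ∀ d ∈ D, (d, 0) ∈ orbitLimitPairs T ∧ (0, d) ∈ orbitLimitPairs T) :
    ∃ x, x ∈ hypercyclicVectors T := by
  have := separableSpace_of_dense_span hc hdense
  have := UniformSpace.secondCountable_of_separable E
  refine exists_denseRange_apply (fun n => (T ^ n).continuous) fun U V hU hUne hV hVne => ?_
  obtain ⟨x, hxU, hx⟩ := hdense.inter_open_nonempty U hU hUne
  obtain ⟨y, hyV, hy⟩ := hdense.inter_open_nonempty V hV hVne
  obtain ⟨z, hzx, hzy⟩ := mk_mem_orbitLimitPairs_of_mem_span hD hx hy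
  obtain ⟨n, hnU, hnV⟩ := ((hzx.eventually (hU.mem_nhds hxU)).and
    (hzy.eventually (hV.mem_nhds hyV))).exists
  exact ⟨n, z n, hnU, hnV⟩

end Mixing

section Interpolation

open Polynomial

theorem exists_X_pow_dvd_sub_and_X_pow_dvd_taylor_sub {R : Type*} [CommRing R] (N : ℕ)
    (p q : R[X]) : ∃ H : R[X], X ^ N ∣ H - p ∧ X ^ N ∣ taylor 1 H - q := by
  obtain ⟨u, v, huv⟩ : IsCoprime (X ^ N : R[X]) ((X - 1) ^ N) := IsCoprime.pow ⟨1, -1, by ring⟩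
  set r : R[X] := taylor (-1) q
  have hdvd : (X - 1) ^ N ∣ p + X ^ N * u * (r - p) - r :=
    ⟨v * (p - r), by linear_combination (r - p) * huv⟩
  refine ⟨p + X ^ N * u * (r - p), ⟨u * (r - p), by ring⟩, ?_⟩
  simpa [r, taylor_taylor] using map_dvd (taylorAlgHom (1 : R)) hdvd

variable {𝕜 : Type*} [Field 𝕜]

/-- The rescaling `p ↦ c ^ j * p (x / c)` of polynomials. It fixes the monomial `X ^ j` and, for
large `c`, damps the higher ones. -/
noncomputable def dilate (j : ℕ) (c : 𝕜) : 𝕜[X] →ₗ[𝕜] 𝕜[X] :=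
  c ^ j • (aeval (C c⁻¹ * X) : 𝕜[X] →ₐ[𝕜] 𝕜[X]).toLinearMap

theorem dilate_apply (j : ℕ) (c : 𝕜) (p : 𝕜[X]) :
    dilate j c p = c ^ j • p.comp (C c⁻¹ * X) := rfl

theorem dilate_X_pow (j i : ℕ) (c : 𝕜) :
    dilate j c (X ^ i : 𝕜[X]) = (c ^ j * c⁻¹ ^ i) • X ^ i := by
  rw [dilate_apply, X_pow_comp, mul_pow, ← C_pow, ← smul_eq_C_mul, smul_smul]

theorem dilate_X_pow_self (j : ℕ) {c : 𝕜} (hc : c ≠ 0) : dilate j c (X ^ j : 𝕜[X]) = X ^ j := by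
  rw [dilate_X_pow, ← mul_pow, mul_inv_cancel₀ hc, one_pow, one_smul]

theorem taylor_dilate (j : ℕ) {c : 𝕜} (hc : c ≠ 0) (p : 𝕜[X]) :
    taylor c (dilate j c p) = dilate j c (taylor 1 p) := by
  simp only [dilate_apply, map_smul, taylor_apply, comp_assoc]
  congr 2
  simp [mul_add, ← C_mul, hc]

theorem sum_inv_factorial_smul_iterate_derivative [CharZero 𝕜] {p : 𝕜[X]} {N : ℕ}
    (hN : p.natDegree < N) :
    ∑ k ∈ Finset.range N, (k.factorial : 𝕜)⁻¹ • derivative^[k] p = taylor 1 p := by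
  ext m
  have hdeg : (hasseDeriv m p).natDegree < N :=
    ((natDegree_hasseDeriv_le p m).trans (Nat.sub_le _ _)).trans_lt hN
  rw [taylor_coeff, eval_eq_sum_range' hdeg, finsetSum_coeff]
  refine Finset.sum_congr rfl fun k _ => ?_
  have hk : (k.factorial : 𝕜) ≠ 0 := Nat.cast_ne_zero.2 k.factorial_ne_zero
  rw [coeff_smul, coeff_iterate_derivative, hasseDeriv_coeff,
    Nat.descFactorial_eq_factorial_mul_choose, one_pow, mul_one, nsmul_eq_mul, smul_eq_mul,
    Nat.cast_mul, mul_assoc, inv_mul_cancel_left₀ hk, add_comm k m, Nat.choose_symm_add]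

end Interpolation

section Damping

open Polynomial Filter Topology

variable {𝕜 E : Type*} [RCLike 𝕜] [NormedAddCommGroup E] [NormedSpace 𝕜 E]

theorem tendsto_map_dilate_X_pow (Φ : 𝕜[X] →ₗ[𝕜] E) {i j : ℕ} (hij : j < i) :
    Tendsto (fun n : ℕ => Φ (dilate j (n : 𝕜) (X ^ i))) atTop (𝓝 0) := by
  obtain ⟨k, rfl⟩ := Nat.exists_eq_add_of_lt hij
  have hpow : Tendsto (fun n : ℕ => (n : 𝕜)⁻¹ ^ (k + 1)) atTop (𝓝 0) := by
    simpa using (tendsto_inv_atTop_nhds_zero_nat (𝕜 := 𝕜)).pow (k + 1)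
  have hsmul := hpow.smul_const (Φ (X ^ (j + k + 1)))
  rw [zero_smul] at hsmul
  refine hsmul.congr' ((eventually_ne_atTop 0).mono fun n hn => ?_)
  have hscalar : (n : 𝕜) ^ j * (n : 𝕜)⁻¹ ^ (j + k + 1) = (n : 𝕜)⁻¹ ^ (k + 1) := by
    rw [add_assoc, pow_add, ← mul_assoc, ← mul_pow, mul_inv_cancel₀ (Nat.cast_ne_zero.2 hn),
      one_pow, one_mul]
  beta_reduce
  rw [dilate_X_pow, hscalar, map_smul]

theorem tendsto_map_dilate_of_X_pow_dvd (Φ : 𝕜[X] →ₗ[𝕜] E) {j : ℕ} {p : 𝕜[X]}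
    (hp : X ^ (j + 1) ∣ p) :
    Tendsto (fun n : ℕ => Φ (dilate j (n : 𝕜) p)) atTop (𝓝 0) := by
  have hsum (n : ℕ) : Φ (dilate j (n : 𝕜) p) =
      ∑ i ∈ p.support, p.coeff i • Φ (dilate j (n : 𝕜) (X ^ i)) := by
    conv_lhs => rw [p.as_sum_support_C_mul_X_pow]
    simp only [← smul_eq_C_mul, map_sum, map_smul]
  simp only [hsum]
  rw [← Finset.sum_const_zero (s := p.support)]
  refine tendsto_finsetSum _ fun i hi => ?_
  have hij : j < i := by
    by_contra! hij
    exact mem_support_iff.1 hi (X_pow_dvd_iff.1 hp i (Nat.lt_succ_of_le hij))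
  simpa using (tendsto_map_dilate_X_pow Φ hij).const_smul (p.coeff i)

theorem tendsto_map_dilate_of_X_pow_dvd_sub (Φ : 𝕜[X] →ₗ[𝕜] E) {j : ℕ} {a : 𝕜} {p : 𝕜[X]}
    (hp : X ^ (j + 1) ∣ p - a • X ^ j) :
    Tendsto (fun n : ℕ => Φ (dilate j (n : 𝕜) p)) atTop (𝓝 (a • Φ (X ^ j))) := by
  rw [← zero_add (a • _)]
  refine ((tendsto_map_dilate_of_X_pow_dvd Φ hp).add_const _).congr'
    ((eventually_ne_atTop 0).mono fun n hn => ?_)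
  rw [map_sub, map_smul, dilate_X_pow_self j (Nat.cast_ne_zero.2 hn), map_sub, map_smul,
    sub_add_cancel]

end Damping

section Exponential

open Polynomial Filter Topology NormedSpace

variable {𝕜 E : Type*} [RCLike 𝕜] [NormedAddCommGroup E] [NormedSpace 𝕜 E]

/-- The image of a polynomial under the umbral substitution `x ^ j ↦ u j`. -/
noncomputable def umbralMap (u : ℕ → E) : 𝕜[X] →ₗ[𝕜] E :=
  (basisMonomials 𝕜).constr 𝕜 u

theorem umbralMap_X_pow (u : ℕ → E) (j : ℕ) :
    umbralMap u (X ^ j : 𝕜[X]) = u j := by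
  rw [← monomial_one_right_eq_X_pow, umbralMap]
  simpa using (basisMonomials 𝕜).constr_basis 𝕜 u j

/-- `u` is an Appell sequence for `B`: the operator `B` acts on `u j` as differentiation does on
the monomial `x ^ j`. For `j = 0` this says `B (u 0) = 0`, whatever the value of `u (0 - 1)`. -/
def IsAppellSequence (B : E →L[𝕜] E) (u : ℕ → E) : Prop :=
  ∀ j, B (u j) = (j : 𝕜) • u (j - 1)

theorem IsAppellSequence.apply_umbralMap {B : E →L[𝕜] E} {u : ℕ → E} (hu : IsAppellSequence B u)
    (p : 𝕜[X]) : B (umbralMap u p) = umbralMap u (derivative p) := by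
  induction p using Polynomial.induction_on' with
  | add p q hp hq => simp only [map_add, hp, hq]
  | monomial j a =>
    rw [← C_mul_X_pow_eq_monomial, ← smul_eq_C_mul, derivative_smul, derivative_X_pow,
      ← smul_eq_C_mul]
    simp only [map_smul, umbralMap_X_pow, hu j]

theorem pow_apply_of_apply_eq_map_derivative {B : E →L[𝕜] E} {Φ : 𝕜[X] →ₗ[𝕜] E}
    (hΦ : ∀ p, B (Φ p) = Φ (derivative p)) (k : ℕ) (p : 𝕜[X]) :
    (B ^ k) (Φ p) = Φ (derivative^[k] p) := by
  induction k generalizing p with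
  | zero => rfl
  | succ k ih => rw [pow_succ, mul_apply_eq_comp, hΦ, ih, Function.iterate_succ_apply]

variable [CompleteSpace E]

theorem exp_apply_of_forall_ge {B : E →L[𝕜] E} {x : E} {N : ℕ} (h : ∀ k ≥ N, (B ^ k) x = 0) :
    exp B x = ∑ k ∈ Finset.range N, (k.factorial : 𝕜)⁻¹ • (B ^ k) x := by
  have hexp := (exp_series_hasSum_exp' (𝕂 := 𝕜) B).mapL (ContinuousLinearMap.apply 𝕜 E x)
  refine hexp.unique (hasSum_sum_of_ne_finset_zero fun k hk => ?_)
  simp [h k (by simpa using hk)]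

theorem exp_apply_of_apply_eq_zero {B : E →L[𝕜] E} {x : E} (h : B x = 0) : exp B x = x := by
  rw [exp_apply_of_forall_ge (N := 1)]
  · simp
  · intro k hk
    rw [← Nat.sub_add_cancel hk, pow_succ, mul_apply_eq_comp, h, map_zero]

theorem exp_pow_apply_of_apply_eq_map_derivative {B : E →L[𝕜] E} {Φ : 𝕜[X] →ₗ[𝕜] E}
    (hΦ : ∀ p, B (Φ p) = Φ (derivative p)) (n : ℕ) (p : 𝕜[X]) :
    (exp B ^ n) (Φ p) = Φ (taylor (n : 𝕜) p) := by
  have hexp (p : 𝕜[X]) : exp B (Φ p) = Φ (taylor 1 p) := by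
    rw [exp_apply_of_forall_ge (N := p.natDegree + 1),
      ← sum_inv_factorial_smul_iterate_derivative p.natDegree.lt_succ_self]
    · simp only [pow_apply_of_apply_eq_map_derivative hΦ, map_sum, map_smul]
    · intro k hk
      rw [pow_apply_of_apply_eq_map_derivative hΦ, iterate_derivative_eq_zero hk, map_zero]
  induction n generalizing p with
  | zero => simp
  | succ n ih =>
    rw [pow_succ, mul_apply_eq_comp, hexp, ih, taylor_taylor, Nat.cast_succ, add_comm]

theorem IsAppellSequence.mk_mem_orbitLimitPairs_exp {B : E →L[𝕜] E} {u : ℕ → E}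
    (hu : IsAppellSequence B u) (j : ℕ) (a b : 𝕜) :
    (a • u j, b • u j) ∈ orbitLimitPairs (exp B) := by
  obtain ⟨H, hH, hH'⟩ := exists_X_pow_dvd_sub_and_X_pow_dvd_taylor_sub (j + 1)
    (a • X ^ j) (b • X ^ j : 𝕜[X])
  rw [← umbralMap_X_pow (𝕜 := 𝕜) u j]
  refine ⟨fun n => umbralMap u (dilate j (n : 𝕜) H), tendsto_map_dilate_of_X_pow_dvd_sub _ hH,
    (tendsto_map_dilate_of_X_pow_dvd_sub _ hH').congr'
      ((eventually_ne_atTop 0).mono fun n hn => ?_)⟩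
  beta_reduce
  rw [exp_pow_apply_of_apply_eq_map_derivative hu.apply_umbralMap,
    taylor_dilate j (Nat.cast_ne_zero.2 hn)]

end Exponential

section Biorthogonal

open Set TopologicalSpace

variable {𝕜 X : Type*} [RCLike 𝕜] [NormedAddCommGroup X] [NormedSpace 𝕜 X]

theorem finiteDimensional_of_dense_span {s : Set X} (hs : s.Finite)
    (hd : Dense (Submodule.span 𝕜 s : Set X)) : FiniteDimensional 𝕜 X := by
  have := FiniteDimensional.span_of_finite 𝕜 hs
  have hclosed := (Submodule.span 𝕜 s).closed_of_finiteDimensional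
  have htop : Submodule.span 𝕜 s = ⊤ :=
    SetLike.coe_injective (hclosed.closure_eq.symm.trans hd.closure_eq)
  exact Module.finite_def.2 (htop ▸ Submodule.fg_span hs)

theorem exists_linearIndependent_dense_span [SeparableSpace X] (hX : ¬ FiniteDimensional 𝕜 X) :
    ∃ x : ℕ → X, LinearIndependent 𝕜 x ∧ Dense (Submodule.span 𝕜 (range x) : Set X) := by
  obtain ⟨b, hb, hspan, hli⟩ := exists_linearIndependent 𝕜 (range (denseSeq X))
  have hd : Dense (Submodule.span 𝕜 b : Set X) := by
    rw [hspan]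
    exact (denseRange_denseSeq X).mono Submodule.subset_span
  have := ((countable_range _).mono hb).to_subtype
  have : Infinite b :=
    infinite_coe_iff.2 fun hfin => hX (finiteDimensional_of_dense_span hfin hd)
  obtain ⟨φ⟩ := nonempty_equiv_of_countable (α := ℕ) (β := b)
  refine ⟨fun n => φ n, hli.comp φ φ.injective, ?_⟩
  have hrange : range (fun n => (φ n : X)) = b :=
    (φ.surjective.range_comp _).trans Subtype.range_coe
  rwa [hrange]

theorem exists_strongDual_apply_eq {ι : Type*} [Finite ι] {v : ι → X}
    (hv : LinearIndependent 𝕜 v) (a : ι → 𝕜) : ∃ g : StrongDual 𝕜 X, ∀ i, g (v i) = a i := by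
  have := Fintype.ofFinite ι
  obtain ⟨g, hg⟩ := (SeparatingDual.dualMap_surjective_iff (R := 𝕜)).2
    hv.fintypeLinearCombination_injective (Fintype.linearCombination 𝕜 a)
  refine ⟨g, fun i => ?_⟩
  classical simpa using LinearMap.congr_fun hg (Pi.single i 1)

theorem exists_strongDual_triangular {x : ℕ → X} (hx : LinearIndependent 𝕜 x) (n : ℕ) :
    ∃ g : StrongDual 𝕜 X, g (x n) = 1 ∧ ∀ k < n, g (x k) = 0 := by
  obtain ⟨g, hg⟩ := exists_strongDual_apply_eq (v := fun i : Fin (n + 1) => x i)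
    (hx.comp _ Fin.val_injective) (Pi.single (Fin.last n) 1)
  refine ⟨g, by simpa using hg (Fin.last n), fun k hk => ?_⟩
  simpa [Fin.ext_iff, hk.ne] using hg ⟨k, hk.trans n.lt_succ_self⟩

/-- The vectors `e i` and the functionals `g i` form a biorthogonal system: `g i (e j) = δᵢⱼ`. -/
structure IsBiorthogonal {ι : Type*} (e : ι → X) (g : ι → StrongDual 𝕜 X) : Prop where
  apply_self : ∀ i, g i (e i) = 1
  apply_of_ne : ∀ {i j}, i ≠ j → g i (e j) = 0

theorem IsBiorthogonal.comp {ι κ : Type*} {e : ι → X} {g : ι → StrongDual 𝕜 X}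
    (h : IsBiorthogonal e g) {φ : κ → ι} (hφ : φ.Injective) : IsBiorthogonal (e ∘ φ) (g ∘ φ) :=
  ⟨fun i => h.apply_self (φ i), fun hij => h.apply_of_ne (hφ.ne hij)⟩

theorem IsBiorthogonal.linearIndependent {ι : Type*} {e : ι → X} {g : ι → StrongDual 𝕜 X}
    (h : IsBiorthogonal e g) : LinearIndependent 𝕜 e :=
  .of_pairwise_dual_eq_zero_one e (fun i => (g i : X →ₗ[𝕜] 𝕜)) (fun _ _ => h.apply_of_ne)
    h.apply_self

/-- The Gram–Schmidt process along the functionals `g`: when `g n (x n) = 1` and `g n` annihilates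
`x 0, …, x (n - 1)`, it makes the sequence `x` biorthogonal to `g`. -/
noncomputable def biorthogonalize (x : ℕ → X) (g : ℕ → StrongDual 𝕜 X) (n : ℕ) : X :=
  x n - ∑ k : Fin n, g k (x n) • biorthogonalize x g k
termination_by n
decreasing_by exact k.2

theorem span_range_le_span_range_biorthogonalize (x : ℕ → X) (g : ℕ → StrongDual 𝕜 X) :
    Submodule.span 𝕜 (range x) ≤ Submodule.span 𝕜 (range (biorthogonalize x g)) := by
  refine Submodule.span_le.2 (range_subset_iff.2 fun n => ?_)
  have hn := biorthogonalize.eq_def x g n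
  rw [eq_sub_iff_add_eq] at hn
  rw [← hn]
  exact add_mem (Submodule.subset_span (mem_range_self n)) <| sum_mem fun k _ =>
    Submodule.smul_mem _ _ (Submodule.subset_span (mem_range_self (k : ℕ)))

theorem isBiorthogonal_biorthogonalize {x : ℕ → X} {g : ℕ → StrongDual 𝕜 X}
    (h1 : ∀ n, g n (x n) = 1) (h0 : ∀ n, ∀ k < n, g n (x k) = 0) :
    IsBiorthogonal (biorthogonalize x g) g := by
  have hpairing (n k : ℕ) : g k (biorthogonalize x g n) = if k = n then 1 else 0 := by
    induction n using Nat.strong_induction_on with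
    | _ n ih =>
      have hsum : ∑ l : Fin n, g l (x n) * g k (biorthogonalize x g l) =
          if k < n then g k (x n) else 0 := by
        rw [Finset.sum_congr rfl fun (l : Fin n) _ => by rw [ih l l.2],
          Fin.sum_univ_eq_sum_range (fun l => g l (x n) * if k = l then 1 else 0) n]
        simp
      rw [biorthogonalize, map_sub, map_sum]
      simp only [map_smul, smul_eq_mul, hsum]
      rcases lt_trichotomy k n with hkn | rfl | hkn
      · simp [hkn, hkn.ne]
      · simp [h1]
      · simp [h0 k n hkn, hkn.ne', hkn.not_gt]
  exact ⟨fun n => by simp [hpairing], fun hij => by simp [hpairing, hij]⟩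

theorem exists_isBiorthogonal_dense_span [SeparableSpace X] (hX : ¬ FiniteDimensional 𝕜 X) :
    ∃ (e : ℕ → X) (g : ℕ → StrongDual 𝕜 X), IsBiorthogonal e g ∧
      Dense (Submodule.span 𝕜 (range e) : Set X) := by
  obtain ⟨x, hx, hd⟩ := exists_linearIndependent_dense_span hX
  choose g h1 h0 using exists_strongDual_triangular hx
  exact ⟨biorthogonalize x g, g, isBiorthogonal_biorthogonalize h1 h0,
    hd.mono (span_range_le_span_range_biorthogonalize x g)⟩

end Biorthogonal

section WeightedShift

open Set TopologicalSpace

variable {𝕜 X : Type*} [RCLike 𝕜] [NormedAddCommGroup X] [NormedSpace 𝕜 X]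

theorem exists_ne_zero_summable_smul {ι : Type*} [Countable ι] [CompleteSpace X] (v : ι → X) :
    ∃ w : ι → 𝕜, (∀ i, w i ≠ 0) ∧ Summable fun i => w i • v i := by
  obtain ⟨δ, hδ, hsum⟩ := ENNReal.exists_pos_tsum_mul_lt_of_countable one_ne_zero
    (fun i => (‖v i‖₊ : ENNReal)) fun _ => ENNReal.coe_ne_top
  simp only [← ENNReal.coe_mul] at hsum
  have hsummable : Summable fun i => ‖v i‖₊ * δ i :=
    ENNReal.tsum_coe_ne_top_iff_summable.1 (hsum.trans ENNReal.one_lt_top).ne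
  refine ⟨fun i => ((δ i : ℝ) : 𝕜), fun i => by simpa using (hδ i).ne', ?_⟩
  refine .of_norm_bounded (NNReal.summable_coe.2 hsummable) fun i => ?_
  simp [norm_smul, mul_comm]

theorem IsBiorthogonal.exists_weighted_shift {ι : Type*} [Countable ι] [CompleteSpace X]
    {e : ι → X} {g : ι → StrongDual 𝕜 X} (h : IsBiorthogonal e g) {σ : ι → ι}
    (hσ : σ.Injective) :
    ∃ (B : X →L[𝕜] X) (w : ι → 𝕜), (∀ i, w i ≠ 0) ∧ (∀ i, B (e (σ i)) = w i • e i) ∧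
      ∀ j ∉ range σ, B (e j) = 0 := by
  obtain ⟨w, hw, hsum⟩ :=
    exists_ne_zero_summable_smul (𝕜 := 𝕜) fun i => (g (σ i)).smulRight (e i)
  have happly (x : X) : HasSum (fun i => w i • g (σ i) x • e i)
      ((∑' i, w i • (g (σ i)).smulRight (e i)) x) :=
    hsum.hasSum.mapL (ContinuousLinearMap.apply 𝕜 X x)
  refine ⟨∑' i, w i • (g (σ i)).smulRight (e i), w, hw, fun i => (happly _).unique ?_,
    fun j hj => (happly _).unique ?_⟩
  · have hsingle := hasSum_single (f := fun k => w k • g (σ k) (e (σ i)) • e k) i fun k hk => by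
      simp [h.apply_of_ne (hσ.ne hk)]
    simpa [h.apply_self] using hsingle
  · have hzero (i : ι) : g (σ i) (e j) = 0 := h.apply_of_ne fun hij => hj ⟨i, hij⟩
    simp [hzero, hasSum_zero]

theorem exists_isAppellSequence_smul {B : X →L[𝕜] X} {e : ℕ → X} {w : ℕ → 𝕜}
    (hw : ∀ j, w j ≠ 0) (h0 : B (e 0) = 0) (hsucc : ∀ j, B (e (j + 1)) = w j • e j) :
    ∃ a : ℕ → 𝕜, (∀ j, a j ≠ 0) ∧ IsAppellSequence B fun j => a j • e j := by
  refine ⟨fun j => j.factorial * ∏ l ∈ Finset.range j, (w l)⁻¹, fun j => ?_, fun j => ?_⟩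
  · exact mul_ne_zero (Nat.cast_ne_zero.2 j.factorial_ne_zero)
      (Finset.prod_ne_zero_iff.2 fun l _ => inv_ne_zero (hw l))
  · cases j with
    | zero => simp [h0]
    | succ j =>
      rw [map_smul, hsucc, smul_smul, Nat.add_sub_cancel, smul_smul]
      congr 1
      beta_reduce
      rw [Finset.prod_range_succ, Nat.factorial_succ, Nat.cast_mul]
      field_simp [hw j]

theorem exists_appell_family [CompleteSpace X] [SeparableSpace X]
    (hX : ¬ FiniteDimensional 𝕜 X) :
    ∃ (B : X →L[𝕜] X) (u : ℕ × ℕ → X), LinearIndependent 𝕜 u ∧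
      Dense (Submodule.span 𝕜 (range u) : Set X) ∧
      ∀ i, IsAppellSequence B fun j => u (i, j) := by
  obtain ⟨e₀, g₀, hbi₀, hd₀⟩ := exists_isBiorthogonal_dense_span hX
  set e : ℕ × ℕ → X := e₀ ∘ Nat.pairEquiv
  have hbi : IsBiorthogonal e (g₀ ∘ Nat.pairEquiv) := hbi₀.comp Nat.pairEquiv.injective
  obtain ⟨B, w, hw, hsucc, hzero⟩ := hbi.exists_weighted_shift (σ := Prod.map id Nat.succ)
    (Function.injective_id.prodMap Nat.succ_injective)
  choose a ha hAppell using fun i => exists_isAppellSequence_smul (e := fun j => e (i, j))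
    (fun j => hw (i, j)) (hzero (i, 0) (by simp)) fun j => hsucc (i, j)
  refine ⟨B, fun p => a p.1 p.2 • e p,
    hbi.linearIndependent.units_smul fun p => Units.mk0 (a p.1 p.2) (ha p.1 p.2), ?_, hAppell⟩
  have hspan : Submodule.span 𝕜 (range e) ≤
      Submodule.span 𝕜 (range fun p => a p.1 p.2 • e p) := by
    refine Submodule.span_le.2 (range_subset_iff.2 fun p => ?_)
    rw [← inv_smul_smul₀ (ha p.1 p.2) (e p)]
    exact Submodule.smul_mem _ _ (Submodule.subset_span (mem_range_self p))
  refine Dense.mono hspan ?_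
  rwa [Nat.pairEquiv.surjective.range_comp e₀]

end WeightedShift

section Diagonal

open Set Filter Topology
open scoped ENNReal

variable {𝕜 E ι : Type*} [RCLike 𝕜] [NormedAddCommGroup E] [NormedSpace 𝕜 E]
  {p : ℝ≥0∞} [Fact (1 ≤ p)]

/-- The operator `T ⊕ T ⊕ ⋯` acting coordinatewise on `ℓᵖ(ι, E)`. -/
noncomputable def diagonalOperator (T : E →L[𝕜] E) :
    lp (fun _ : ι => E) p →L[𝕜] lp (fun _ : ι => E) p :=
  lp.mapCLM p (fun _ => T) (norm_nonneg T) fun _ => le_rfl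

theorem diagonalOperator_pow_apply (T : E →L[𝕜] E) (n : ℕ) (h : lp (fun _ : ι => E) p) (i : ι) :
    (diagonalOperator T ^ n) h i = (T ^ n) (h i) := by
  induction n generalizing h with
  | zero => rfl
  | succ _ ih => exact ih (diagonalOperator T h)

theorem diagonalOperator_pow_single [DecidableEq ι] (T : E →L[𝕜] E) (n : ℕ) (i : ι) (x : E) :
    (diagonalOperator T ^ n) (lp.single p i x) = lp.single p i ((T ^ n) x) := by
  ext k
  rw [diagonalOperator_pow_apply]
  obtain rfl | hk := eq_or_ne k i <;> simp [*]

theorem single_mem_orbitLimitPairs [DecidableEq ι] {T : E →L[𝕜] E} {x y : E}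
    (h : (x, y) ∈ orbitLimitPairs T) (i : ι) :
    ((lp.single p i x : lp (fun _ : ι => E) p), lp.single p i y) ∈
      orbitLimitPairs (diagonalOperator T) := by
  obtain ⟨z, hzx, hzy⟩ := h
  have hcont : Continuous (lp.single (E := fun _ : ι => E) p i) := (lp.isometry_single i).continuous
  refine ⟨fun n => lp.single p i (z n), (hcont.tendsto x).comp hzx, ?_⟩
  simpa only [diagonalOperator_pow_single] using! (hcont.tendsto y).comp hzy

theorem dense_span_iUnion_single [DecidableEq ι] (hp : p ≠ ∞) {D : Set E}
    (hD : Dense (Submodule.span 𝕜 D : Set E)) :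
    Dense (Submodule.span 𝕜 (⋃ i, lp.single (E := fun _ : ι => E) p i '' D) :
      Set (lp (fun _ : ι => E) p)) := by
  set S := Submodule.span 𝕜 (⋃ i, lp.single (E := fun _ : ι => E) p i '' D)
  have hle (i : ι) :
      Submodule.span 𝕜 D ≤ S.comap (lp.lsingle (𝕜 := 𝕜) (E := fun _ : ι => E) p i) :=
    Submodule.span_le.2 fun d hd => Submodule.subset_span (mem_iUnion.2 ⟨i, d, hd, rfl⟩)
  have hsingle (i : ι) (x : E) :
      lp.single (E := fun _ : ι => E) p i x ∈ S.topologicalClosure :=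
    map_mem_closure (lp.isometry_single i).continuous (hD x) fun y hy => hle i hy
  exact fun h => S.isClosed_topologicalClosure.mem_of_tendsto (lp.hasSum_single hp h)
    (.of_forall fun s => sum_mem fun i _ => hsingle i (h i))

theorem exists_mem_hypercyclicVectors_diagonalOperator [Countable ι] [CompleteSpace E] (hp : p ≠ ∞)
    {T : E →L[𝕜] E} {D : Set E} (hc : D.Countable) (hdense : Dense (Submodule.span 𝕜 D : Set E))
    (hD : ∀ d ∈ D, (d, 0) ∈ orbitLimitPairs T ∧ (0, d) ∈ orbitLimitPairs T) :
    ∃ h : lp (fun _ : ι => E) p, h ∈ hypercyclicVectors (diagonalOperator T) := by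
  classical
  refine exists_mem_hypercyclicVectors (countable_iUnion fun i => hc.image _)
    (dense_span_iUnion_single hp hdense) fun d' hd' => ?_
  obtain ⟨i, d, hd, rfl⟩ := mem_iUnion.1 hd'
  exact ⟨by simpa using single_mem_orbitLimitPairs (hD d hd).1 i,
    by simpa using single_mem_orbitLimitPairs (hD d hd).2 i⟩

theorem exists_eqOn_id_and_mem_hypercyclicVectors_diagonalOperator [Countable ι] [CompleteSpace E]
    [TopologicalSpace.SeparableSpace E] (hE : ¬ FiniteDimensional 𝕜 E) (hp : p ≠ ∞) :
    ∃ (T : E →L[𝕜] E) (M : Submodule 𝕜 E) (h : lp (fun _ : ι => E) p),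
      IsClosed (M : Set E) ∧ ¬ FiniteDimensional 𝕜 M ∧ EqOn T id M ∧
        h ∈ hypercyclicVectors (diagonalOperator T) := by
  obtain ⟨B, u, hli, hdense, hu⟩ := exists_appell_family hE
  obtain ⟨h, hh⟩ := exists_mem_hypercyclicVectors_diagonalOperator (ι := ι) hp
    (T := NormedSpace.exp B) (countable_range u) hdense <| by
      rintro _ ⟨⟨i, j⟩, rfl⟩
      exact ⟨by simpa using (hu i).mk_mem_orbitLimitPairs_exp j 1 0,
        by simpa using (hu i).mk_mem_orbitLimitPairs_exp j 0 1⟩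
  have hker (i : ℕ) : B (u (i, 0)) = 0 := by simpa using hu i 0
  have hlindep : LinearIndependent 𝕜 fun i => (⟨u (i, 0), hker i⟩ : B.ker) :=
    .of_comp B.ker.subtype (hli.comp (fun i => (i, 0)) (Prod.mk_left_injective 0))
  exact ⟨NormedSpace.exp B, B.ker, h, B.isClosed_ker,
    fun hfin => not_finite_iff_infinite.2 inferInstance hlindep.finite,
    fun m hm => exp_apply_of_apply_eq_zero hm, hh⟩

theorem denseRange_pair_of_mem_hypercyclicVectors_diagonalOperator {T : E →L[𝕜] E} {i j : ι}
    (hij : i ≠ j) {h : lp (fun _ : ι => E) p} (hh : h ∈ hypercyclicVectors (diagonalOperator T)) :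
    DenseRange fun n : ℕ => ((T ^ n) (h i), (T ^ n) (h j)) := by
  classical
  set π := (lp.evalCLM 𝕜 (fun _ : ι => E) p i).prod (lp.evalCLM 𝕜 (fun _ : ι => E) p j)
  have hπ_apply (g : lp (fun _ : ι => E) p) : π g = (g i, g j) := rfl
  have hπ : Function.Surjective π := fun y =>
    ⟨lp.single p i y.1 + lp.single p j y.2, by simp [hπ_apply, hij, hij.symm]⟩
  simpa only [Function.comp_def, hπ_apply, diagonalOperator_pow_apply] using
    hπ.denseRange.comp hh π.continuous

end Diagonal

section NuclearPerturbation

open Set TopologicalSpace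

variable {𝕜 X Y ι : Type*} [RCLike 𝕜] [NormedAddCommGroup X] [NormedSpace 𝕜 X]
  [NormedAddCommGroup Y] [NormedSpace 𝕜 Y]

theorem exists_separating_sequence [SeparableSpace X] :
    ∃ f : ℕ → StrongDual 𝕜 X, (∀ i, ‖f i‖ ≤ 1) ∧ ∀ x, (∀ i, f i x = 0) → x = 0 := by
  choose f hf hfx using fun i : ℕ => exists_dual_vector'' 𝕜 (denseSeq X i)
  refine ⟨f, hf, fun x hx => norm_le_zero_iff.1 (le_of_forall_pos_lt_add fun ε hε => ?_)⟩
  obtain ⟨i, hi⟩ := (denseRange_denseSeq X).exists_dist_lt x (half_pos hε)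
  set y := denseSeq X i
  rw [dist_eq_norm] at hi
  have hy : ‖y‖ ≤ ‖x - y‖ := by
    calc ‖y‖ = ‖f i (x - y)‖ := by simp [hx, hfx, y]
      _ ≤ ‖x - y‖ := by simpa using (f i).le_of_opNorm_le (hf i) (x - y)
  linarith [norm_le_norm_sub_add x y]

theorem norm_smulRightL_apply_le (g : StrongDual 𝕜 X) :
    ‖ContinuousLinearMap.smulRightL 𝕜 X Y g‖ ≤ ‖g‖ :=
  ContinuousLinearMap.opNorm_le_bound _ (norm_nonneg g) fun y =>
    (ContinuousLinearMap.norm_smulRight_apply g y).le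

/-- The continuous linear map `h ↦ ∑ i, f i ⊗ h i` from `ℓ¹(ι, Y)` to the nuclear operators
`X → Y`, where `f` is a family of functionals in the unit ball of the dual of `X`. -/
noncomputable def nuclearOperator [CompleteSpace Y] (f : ι → StrongDual 𝕜 X)
    (hf : ∀ i, ‖f i‖ ≤ 1) : lp (fun _ : ι => Y) 1 →L[𝕜] (X →L[𝕜] Y) :=
  lp.tsumCLM 𝕜 ι (X →L[𝕜] Y) ∘L
    lp.mapCLM 1 (fun i => ContinuousLinearMap.smulRightL 𝕜 X Y (f i)) zero_le_one fun i =>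
      (norm_smulRightL_apply_le (f i)).trans (hf i)

section

variable [CompleteSpace Y] {f : ι → StrongDual 𝕜 X} (hf : ∀ i, ‖f i‖ ≤ 1)

theorem hasSum_nuclearOperator_apply (h : lp (fun _ : ι => Y) 1) (x : X) :
    HasSum (fun i => f i x • h i) (nuclearOperator f hf h x) := by
  have hsum := (lp.memℓp (lp.mapCLM 1 (fun i => ContinuousLinearMap.smulRightL 𝕜 X Y (f i))
    zero_le_one (fun i => (norm_smulRightL_apply_le (f i)).trans (hf i)) h)).summable_of_one.hasSum
  exact hsum.mapL (ContinuousLinearMap.apply 𝕜 Y x)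

theorem nuclearOperator_single_apply [DecidableEq ι] (i : ι) (x : X) (y : Y) :
    nuclearOperator f hf (lp.single 1 i y) x = f i x • y := by
  refine (hasSum_nuclearOperator_apply hf _ x).unique ?_
  simpa using hasSum_single (f := fun k => f k x • lp.single (E := fun _ => Y) 1 i y k) i
    fun k hk => by simp [hk]

theorem nuclearOperator_diagonalOperator_pow_apply (T : Y →L[𝕜] Y) (n : ℕ)
    (h : lp (fun _ : ι => Y) 1) (x : X) :
    nuclearOperator f hf ((diagonalOperator T ^ n) h) x = (T ^ n) (nuclearOperator f hf h x) := by
  refine (hasSum_nuclearOperator_apply hf _ x).unique ?_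
  simpa only [diagonalOperator_pow_apply, map_smul] using
    (hasSum_nuclearOperator_apply hf h x).mapL (T ^ n)

theorem denseRange_add_smul_nuclearOperator {α : Type*} {o : α → lp (fun _ : ι => Y) 1}
    (ho : DenseRange o) {x : X} (hx : ∃ i, f i x ≠ 0) {c : 𝕜} (hc : c ≠ 0) (y : Y) :
    DenseRange fun a => y + c • nuclearOperator f hf (o a) x := by
  classical
  obtain ⟨i, hi⟩ := hx
  have hsurj : Function.Surjective fun g => y + c • nuclearOperator f hf g x := fun z =>
    ⟨lp.single 1 i ((f i x)⁻¹ • c⁻¹ • (z - y)), by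
      simp only [nuclearOperator_single_apply, smul_inv_smul₀ hi, smul_inv_smul₀ hc,
        add_sub_cancel]⟩
  exact hsurj.denseRange.comp ho (by fun_prop)

end

variable [CompleteSpace X]

theorem add_smul_nuclearOperator_mem_hypercyclicVectors {T : X →L[𝕜] X}
    {f : ι → StrongDual 𝕜 X} (hf : ∀ i, ‖f i‖ ≤ 1) {h : lp (fun _ : ι => X) 1}
    (hh : h ∈ hypercyclicVectors (diagonalOperator T)) {m : X} (hTm : T m = m)
    (hm : ∃ i, f i m ≠ 0) {c : 𝕜} (hc : c ≠ 0) :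
    m + c • nuclearOperator f hf h m ∈ hypercyclicVectors T := by
  have hfix (n : ℕ) : (T ^ n) m = m := by
    rw [FunLike.coe_pow_eq_iterate]
    exact Function.iterate_fixed hTm n
  have horbit := denseRange_add_smul_nuclearOperator hf hh hm hc m
  simp only [nuclearOperator_diagonalOperator_pow_apply] at horbit
  simpa only [hypercyclicVectors, mem_ofPred_eq, map_add, map_smul, hfix] using! horbit

theorem exists_continuousLinearEquiv_eq_add_smul (R : X →L[𝕜] X) :
    ∃ c : 𝕜, c ≠ 0 ∧ ∃ L : X ≃L[𝕜] X, ∀ x, L x = x + c • R x := by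
  have hpos : 0 < ‖R‖ + 1 := by positivity
  set c : 𝕜 := RCLike.ofReal (‖R‖ + 1)⁻¹
  have hc : c ≠ 0 := by simpa only [c, ne_eq, RCLike.ofReal_eq_zero] using (inv_pos.2 hpos).ne'
  have hlt : ‖-(c • R)‖ < 1 := by
    rw [norm_neg, norm_smul, RCLike.norm_ofReal, abs_of_pos (inv_pos.2 hpos),
      inv_mul_lt_one₀ hpos]
    exact lt_add_one _
  exact ⟨c, hc, ContinuousLinearEquiv.unitsEquiv 𝕜 X (Units.oneSub _ hlt), by simp⟩

theorem exists_isHypercyclicSubspace [SeparableSpace X] {T : X →L[𝕜] X} {M : Submodule 𝕜 X}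
    {h : lp (fun _ : ℕ => X) 1} (hMc : IsClosed (M : Set X)) (hM : ¬ FiniteDimensional 𝕜 M)
    (hTM : EqOn T id M) (hh : h ∈ hypercyclicVectors (diagonalOperator T)) :
    ∃ Y : Submodule 𝕜 X, IsHypercyclicSubspace T Y := by
  obtain ⟨f, hf, hsep⟩ := exists_separating_sequence (𝕜 := 𝕜) (X := X)
  obtain ⟨c, hc, S, hS⟩ := exists_continuousLinearEquiv_eq_add_smul (nuclearOperator f hf h)
  refine ⟨M.map (S.toLinearEquiv : X →ₗ[𝕜] X), S.isClosed_image.2 hMc, fun hfin => hM ?_, ?_⟩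
  · exact (S.toLinearEquiv.submoduleMap M).symm.finiteDimensional
  · rintro _ ⟨m, hm, rfl⟩ hSm
    have hfm : ∃ i, f i m ≠ 0 := by
      by_contra! hzero
      exact hSm (by simp [hsep m hzero])
    exact (hS m).symm ▸ add_smul_nuclearOperator_mem_hypercyclicVectors hf hh (hTM hm) hfm hc

end NuclearPerturbation

section Conjugation

open Set

theorem denseRange_homeomorph_comp_iff {α β ι : Type*} [TopologicalSpace α] [TopologicalSpace β]
    (φ : α ≃ₜ β) {o : ι → α} : DenseRange (φ ∘ o) ↔ DenseRange o :=
  ⟨fun h => by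
    simpa only [Function.comp_def, φ.symm_apply_apply] using
      φ.symm.surjective.denseRange.comp h φ.symm.continuous,
    fun h => φ.surjective.denseRange.comp h φ.continuous⟩

theorem finrank_eq_one_of_disjoint_ker {K V : Type*} [Field K] [AddCommGroup V] [Module K V]
    {W : Submodule K V} (hW : W ≠ ⊥) {f : V →ₗ[K] K} (hf : Disjoint W f.ker) :
    Module.finrank K W = 1 := by
  have hinj : Function.Injective (f.domRestrict W) :=
    LinearMap.injective_domRestrict_iff.2 hf
  have : Module.Finite K W := .of_injective _ hinj
  have : Nontrivial W := Submodule.nontrivial_iff_ne_bot.2 hW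
  have hle := LinearMap.finrank_le_finrank_of_injective hinj
  rw [Module.finrank_self] at hle
  exact hle.antisymm Module.finrank_pos

theorem not_finite_inf_ker {K V : Type*} [Field K] [AddCommGroup V] [Module K V]
    {Y : Submodule K V} (hY : ¬ Module.Finite K Y) (f : V →ₗ[K] K) :
    ¬ Module.Finite K ↥(Y ⊓ f.ker) := fun h =>
  hY (Module.Finite.iff_fg.2 (Submodule.fg_of_fg_map_of_fg_inf_ker f
    (IsNoetherian.noetherian _) (Module.Finite.iff_fg.1 h)))

variable {𝕜 X : Type*} [RCLike 𝕜] [NormedAddCommGroup X] [NormedSpace 𝕜 X]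

theorem dense_setOf_apply_ne_zero {f : StrongDual 𝕜 X} (hf : f ≠ 0) : Dense {x | f x ≠ 0} := by
  have hker : interior (f.ker : Set X) = ∅ := by
    by_contra hint
    have htop := Submodule.eq_top_of_nonempty_interior' _ (nonempty_iff_ne_empty.2 hint)
    exact hf (ContinuousLinearMap.ext fun x => htop.ge Submodule.mem_top)
  exact interior_eq_empty_iff_dense_compl.1 hker

variable {T : X →L[𝕜] X}

theorem denseRange_apply_add_pow_apply {a v : X}
    (h : DenseRange fun n : ℕ => ((T ^ n) a, (T ^ n) v)) (k : ℕ) :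
    DenseRange fun n : ℕ => ((T ^ n) (a + (T ^ k) v), (T ^ n) v) := by
  have hsurj : Function.Surjective fun p : X × X => (p.1 + (T ^ k) p.2, p.2) := fun p =>
    ⟨(p.1 - (T ^ k) p.2, p.2), by simp only [sub_add_cancel]⟩
  have hcomm (n : ℕ) : (T ^ n) ((T ^ k) v) = (T ^ k) ((T ^ n) v) :=
    DFunLike.congr_fun (Commute.pow_pow_self T n k).eq v
  simpa only [Function.comp_def, map_add, hcomm] using hsurj.denseRange.comp h (by fun_prop)

variable {L : X ≃L[𝕜] X}

theorem conj_pow_apply (T : X →L[𝕜] X) (L : X ≃L[𝕜] X) (n : ℕ) (x : X) :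
    (L.symm.conjContinuousAlgEquiv T ^ n) x = L.symm ((T ^ n) (L x)) := by
  rw [← map_pow, ContinuousLinearEquiv.conjContinuousAlgEquiv_apply_apply,
    ContinuousLinearEquiv.symm_symm]

theorem mem_hypercyclicVectors_conj_iff {x : X} :
    x ∈ hypercyclicVectors (L.symm.conjContinuousAlgEquiv T) ↔ L x ∈ hypercyclicVectors T := by
  have horbit : (fun n : ℕ => (L.symm.conjContinuousAlgEquiv T ^ n) x) =
      L.symm.toHomeomorph ∘ fun n : ℕ => (T ^ n) (L x) := funext (conj_pow_apply T L · x)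
  change DenseRange _ ↔ DenseRange _
  rw [horbit, denseRange_homeomorph_comp_iff]

theorem mem_dHypercyclicVectors_conj_iff {x : X} :
    x ∈ dHypercyclicVectors ![T, L.symm.conjContinuousAlgEquiv T] ↔
      DenseRange fun n : ℕ => ((T ^ n) x, (T ^ n) (L x)) := by
  set φ := Homeomorph.finTwoArrow.trans ((Homeomorph.refl X).prodCongr L.toHomeomorph)
  have horbit : (fun n : ℕ => ((T ^ n) x, (T ^ n) (L x))) = φ ∘ fun (n : ℕ) (i : Fin 2) =>
      (![T, L.symm.conjContinuousAlgEquiv T] i ^ n) x := by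
    ext n
    · rfl
    · exact ((L.eq_symm_apply).1 (conj_pow_apply T L n x)).symm
  rw [horbit, denseRange_homeomorph_comp_iff]
  rfl

theorem apply_ne_self_of_mem_dHypercyclicVectors_conj [Nontrivial X] {x : X}
    (hx : x ∈ dHypercyclicVectors ![T, L.symm.conjContinuousAlgEquiv T]) : L x ≠ x := by
  intro hLx
  have hdiagonal : Dense (diagonal X) := by
    refine (mem_dHypercyclicVectors_conj_iff.1 hx).mono (range_subset_iff.2 fun n => ?_)
    simp only [hLx, mem_diagonal]
  obtain ⟨y, hy⟩ := exists_ne (0 : X)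
  exact hy (show (y, 0) ∈ diagonal X from
    (isClosed_diagonal.closure_eq.symm.trans hdiagonal.closure_eq) ▸ mem_univ _)

theorem finrank_eq_one_of_subset_dHypercyclicVectors_conj {f : StrongDual 𝕜 X}
    (hL : ∀ x, f x = 0 → L x = x) {W : Submodule 𝕜 X} (hW : W ≠ ⊥)
    (hsub : (W : Set X) ⊆ dHypercyclicVectors ![T, L.symm.conjContinuousAlgEquiv T] ∪ {0}) :
    Module.finrank 𝕜 W = 1 := by
  have : Nontrivial W := Submodule.nontrivial_iff_ne_bot.2 hW
  have : Nontrivial X := W.injective_subtype.nontrivial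
  refine finrank_eq_one_of_disjoint_ker hW (f := f) (Submodule.disjoint_def.2 fun w hw hfw => ?_)
  exact (hsub hw).resolve_left fun h => apply_ne_self_of_mem_dHypercyclicVectors_conj h (hL w hfw)

theorem mem_dHypercyclicVectors_conj_of_denseRange {v x : X} {c : 𝕜} (hc : c ≠ 0)
    (hLx : L x = x + c • v) (hx : DenseRange fun n : ℕ => ((T ^ n) x, (T ^ n) v)) :
    x ∈ dHypercyclicVectors ![T, L.symm.conjContinuousAlgEquiv T] := by
  have hsurj : Function.Surjective fun p : X × X => (p.1, p.1 + c • p.2) := fun p =>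
    ⟨(p.1, c⁻¹ • (p.2 - p.1)), by simp only [smul_inv_smul₀ hc, add_sub_cancel]⟩
  rw [mem_dHypercyclicVectors_conj_iff, hLx]
  simpa only [Function.comp_def, map_add, map_smul] using hsurj.denseRange.comp hx (by fun_prop)

theorem denselyDHypercyclic_conj {f : StrongDual 𝕜 X} (hf : f ≠ 0) {a v : X}
    (hL : ∀ x, L x = x + f x • v) (h : DenseRange fun n : ℕ => ((T ^ n) a, (T ^ n) v)) :
    DenselyDHypercyclic ![T, L.symm.conjContinuousAlgEquiv T] := by
  have hv : DenseRange fun k : ℕ => (T ^ k) v :=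
    Prod.snd_surjective.denseRange.comp h continuous_snd
  have htranslate : DenseRange fun k : ℕ => a + (T ^ k) v :=
    (denseRange_homeomorph_comp_iff (Homeomorph.addLeft a)).2 hv
  refine (htranslate.inter_of_isOpen_right (dense_setOf_apply_ne_zero hf)
    (isOpen_ne_fun f.continuous continuous_const)).mono ?_
  rintro _ ⟨⟨k, rfl⟩, hfx⟩
  exact mem_dHypercyclicVectors_conj_of_denseRange hfx (hL _) (denseRange_apply_add_pow_apply h k)

theorem IsHypercyclicSubspace.inf_ker {Y : Submodule 𝕜 X} (hY : IsHypercyclicSubspace T Y)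
    (f : StrongDual 𝕜 X) : IsHypercyclicSubspace T (Y ⊓ f.ker) :=
  ⟨hY.1.inter f.isClosed_ker, not_finite_inf_ker hY.2.1 _, fun y hy => hY.2.2 y hy.1⟩

theorem IsHypercyclicSubspace.conj {Y : Submodule 𝕜 X} (hY : IsHypercyclicSubspace T Y)
    (hL : ∀ y ∈ Y, L y = y) : IsHypercyclicSubspace (L.symm.conjContinuousAlgEquiv T) Y :=
  ⟨hY.1, hY.2.1, fun y hy hy0 =>
    mem_hypercyclicVectors_conj_iff.2 ((hL y hy).symm ▸ hY.2.2 y hy hy0)⟩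

theorem not_isDHypercyclicSubspace_of_finrank_eq_one {N : ℕ} {S : Fin N → (X →L[𝕜] X)}
    (h : ∀ W : Submodule 𝕜 X, W ≠ ⊥ → (W : Set X) ⊆ dHypercyclicVectors S ∪ {0} →
      Module.finrank 𝕜 W = 1) (Y : Submodule 𝕜 X) : ¬ IsDHypercyclicSubspace S Y := by
  rintro ⟨-, hinf, hY⟩
  have hne : Y ≠ ⊥ := by
    rintro rfl
    exact hinf inferInstance
  refine hinf (Module.finite_of_finrank_eq_succ (h Y hne fun y hy => ?_))
  exact (eq_or_ne y 0).symm.imp_left (hY y hy)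

end Conjugation

theorem corollary3p2 {𝕜 X : Type*} [RCLike 𝕜] [NormedAddCommGroup X] [NormedSpace 𝕜 X]
    [CompleteSpace X] [TopologicalSpace.SeparableSpace X] (hX : ¬ FiniteDimensional 𝕜 X) :
    ∃ T₁ T₂ : X →L[𝕜] X,
      DenselyDHypercyclic ![T₁, T₂] ∧
      (∃ Y : Submodule 𝕜 X, IsHypercyclicSubspace T₁ Y ∧ IsHypercyclicSubspace T₂ Y) ∧
      (¬ ∃ Y : Submodule 𝕜 X, IsDHypercyclicSubspace ![T₁, T₂] Y) ∧
      (∀ W : Submodule 𝕜 X, W ≠ ⊥ →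
        (W : Set X) ⊆ dHypercyclicVectors ![T₁, T₂] ∪ {0} → Module.finrank 𝕜 W = 1) := by
  have : Nontrivial X := not_subsingleton_iff_nontrivial.1 fun _ => hX inferInstance
  obtain ⟨T, M, h, hMc, hM, hTM, hh⟩ :=
    exists_eqOn_id_and_mem_hypercyclicVectors_diagonalOperator (ι := ℕ) hX ENNReal.one_ne_top
  obtain ⟨Y, hY⟩ := exists_isHypercyclicSubspace hMc hM hTM hh
  have hpair := denseRange_pair_of_mem_hypercyclicVectors_diagonalOperator one_ne_zero hh
  obtain ⟨f, hf⟩ := exists_ne (0 : StrongDual 𝕜 X)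
  obtain ⟨c, hc, L, hL⟩ := exists_continuousLinearEquiv_eq_add_smul (f.smulRight (h 0))
  have hrankOne (x : X) : L x = x + (c • f) x • h 0 := by simp [hL, smul_smul]
  have hfix (x : X) (hx : f x = 0) : L x = x := by simp [hL, hx]
  have hdim (W : Submodule 𝕜 X) (hW : W ≠ ⊥) hsub :=
    finrank_eq_one_of_subset_dHypercyclicVectors_conj (T := T) hfix hW hsub
  exact ⟨T, L.symm.conjContinuousAlgEquiv T,
    denselyDHypercyclic_conj (smul_ne_zero hc hf) hrankOne hpair,
    ⟨Y ⊓ f.ker, hY.inf_ker f, (hY.inf_ker f).conj fun y hy => hfix y hy.2⟩,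
    fun ⟨Z, hZ⟩ => not_isDHypercyclicSubspace_of_finrank_eq_one hdim Z hZ, hdim⟩
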